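/- Let $n\ge 2$ and $q\le -2$. For a nonempty compact set $K\subset\mathbb R^n$ put $$V_q(K)=\max_\mu\int_K\int_K |x-y|^{-q}\,d\mu(x)\,d\mu(y),\qquad \mathrm{Cap}_q(K)=V_q(K)^{-1/q},$$ where $\mu$ ranges over the Borel probability measures on $K$; a measure $\mu$ attaining the maximum is called a $q$-equilibrium measure of $K$. A regular $(n+1)$-point set is the set of vertices of a (nondegenerate) regular $n$-simplex in $\mathbb R^n$; such sets exist. Among compact sets $K\subset\mathbb R^n$ containing more than one point, every regular $(n+1)$-point set maximizes the ratio $\mathrm{Cap}_q(K)/\mathrm{diam}(K)$. Further, if $K$ is any maximizing set, then $K$ has a $q$-equilibrium measure, and every $q$-equilibrium measure $\mu$ of $K$ is the uniform probability measure on some regular $(n+1)$-point subset $T\subset K$ with $\mathrm{Cap}_q(T)=\mathrm{Cap}_q(K)$ and $\mathrm{diam}(T)=\mathrm{diam}(K)$. -/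

import Mathlib

open MeasureTheory ProbabilityTheory

namespace RieszCap

/-- `μ` is a probability measure on `K`: a Borel probability measure on `ℝⁿ`
that gives no mass to the complement of `K`. -/
def IsProbOn {n : ℕ} (K : Set (EuclideanSpace ℝ (Fin n)))
    (μ : Measure (EuclideanSpace ℝ (Fin n))) : Prop :=
  IsProbabilityMeasure μ ∧ μ Kᶜ = 0

/-- The Riesz `q`-energy `∬ |x - y|^{-q} dμ(x) dμ(y)` of a measure. It is used only for `q < 0` and
for probability measures on compact sets, where the kernel is continuous and bounded almost
everywhere, so that the integrals converge. -/
noncomputable def measureEnergy {n : ℕ} (q : ℝ) (μ : Measure (EuclideanSpace ℝ (Fin n))) : ℝ :=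
  ∫ x, ∫ y, dist x y ^ (-q) ∂μ ∂μ

/-- The Riesz `q`-energy `V_q(K)` of a nonempty compact set, for negative exponent `q`: the largest
energy of a probability measure on `K`. (For `q < 0` the energy is maximized.) -/
noncomputable def rieszEnergy {n : ℕ} (q : ℝ) (K : Set (EuclideanSpace ℝ (Fin n))) : ℝ :=
  sSup {v : ℝ | ∃ μ : Measure (EuclideanSpace ℝ (Fin n)), IsProbOn K μ ∧ measureEnergy q μ = v}

/-- The Riesz `q`-capacity `V_q(K)^{-1/q}`, for negative exponent `q`. -/
noncomputable def rieszCapacity {n : ℕ} (q : ℝ) (K : Set (EuclideanSpace ℝ (Fin n))) : ℝ :=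
  rieszEnergy q K ^ (-1 / q)

/-- A `q`-equilibrium measure of `K`, for negative exponent `q`: a probability measure on `K` whose
energy is maximal among probability measures on `K`. -/
def IsEquilibrium {n : ℕ} (q : ℝ) (K : Set (EuclideanSpace ℝ (Fin n)))
    (μ : Measure (EuclideanSpace ℝ (Fin n))) : Prop :=
  IsProbOn K μ ∧
    ∀ ν : Measure (EuclideanSpace ℝ (Fin n)), IsProbOn K ν → measureEnergy q ν ≤ measureEnergy q μ

/-- `T` is a regular `(m+1)`-point set in `ℝⁿ`: the set of vertices of a nondegenerate
`m`-simplex all of whose edges have the same length. -/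
def IsRegularPointSet {n : ℕ} (m : ℕ) (T : Set (EuclideanSpace ℝ (Fin n))) : Prop :=
  ∃ s : Affine.Simplex ℝ (EuclideanSpace ℝ (Fin n)) m, s.Equilateral ∧ Set.range s.points = T

/-- `K` maximizes the ratio of `q`-capacity to diameter among compact subsets of `ℝⁿ` containing
more than one point (and is itself such a set). -/
def IsMaximizer {n : ℕ} (q : ℝ) (K : Set (EuclideanSpace ℝ (Fin n))) : Prop :=
  IsCompact K ∧ K.Nontrivial ∧
    ∀ L : Set (EuclideanSpace ℝ (Fin n)), IsCompact L → L.Nontrivial →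
      rieszCapacity q L / Metric.diam L ≤ rieszCapacity q K / Metric.diam K

end RieszCap

namespace RieszCap

/-! Write `p = -q ≥ 2`, `D = diam K`, and `I₂`, `I₄` for the double integrals of the second and
fourth powers of the distance against `μ`. Since `d ^ p ≤ D ^ (p - 2) * d ^ 2` for `d ≤ D`, it
suffices to bound `I₂`. Centring at the mean and comparing trace with Hilbert-Schmidt norm of the
second moment matrix gives `(n + 1) I₂² ≤ n I₄` (`IsProbOn.le_integral_dist_pow_four`). Trivially
`I₄ ≤ D² I₂`, so `I₂ ≤ D² n / (n + 1)` and the energy is at most `D ^ p * n / (n + 1)`. The uniform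
measure on a regular `(n+1)`-point set attains this. In the equality case `d² (D² - d²)` vanishes on
pairs from the support, so the support is equidistant. Applied to uniform measures, the bound allows
at most `n + 1` equidistant points. The energy there is `D ^ p * (1 - ∑ w²)`, so extremality forces
`n + 1` points of equal weight (`card_eq_and_uniform`). -/

/-! ### Second and fourth moments of the distance -/

lemma IsProbOn.ae_mem {n : ℕ} {K : Set (EuclideanSpace ℝ (Fin n))}
    {μ : Measure (EuclideanSpace ℝ (Fin n))} (h : IsProbOn K μ) : ∀ᵐ x ∂μ, x ∈ K :=
  mem_ae_iff.2 h.2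

lemma IsProbOn.integrable {n : ℕ} {K : Set (EuclideanSpace ℝ (Fin n))}
    {μ : Measure (EuclideanSpace ℝ (Fin n))} (h : IsProbOn K μ) (hK : IsCompact K)
    {F : Type*} [NormedAddCommGroup F] {g : EuclideanSpace ℝ (Fin n) → F}
    (hg : Continuous g) : Integrable g μ := by
  have := h.1
  rw [← Measure.restrict_eq_self_of_ae_mem h.ae_mem]
  exact hg.continuousOn.integrableOn_compact hK

lemma IsProbOn.integrable_prod {n : ℕ} {K : Set (EuclideanSpace ℝ (Fin n))}
    {μ : Measure (EuclideanSpace ℝ (Fin n))} (h : IsProbOn K μ) (hK : IsCompact K)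
    {F : Type*} [NormedAddCommGroup F]
    {g : EuclideanSpace ℝ (Fin n) × EuclideanSpace ℝ (Fin n) → F}
    (hg : Continuous g) : Integrable g (μ.prod μ) := by
  have := h.1
  have h2 : (μ.prod μ).restrict (K ×ˢ K) = μ.prod μ := by
    rw [← Measure.prod_restrict, Measure.restrict_eq_self_of_ae_mem h.ae_mem]
  rw [← h2]
  exact hg.continuousOn.integrableOn_compact (hK.prod hK)

/-- The second moment matrix of `μ` about `m` has Hilbert-Schmidt norm at least its trace divided
by the square root of the dimension. -/
lemma IsProbOn.sq_moment_le {n : ℕ} {K : Set (EuclideanSpace ℝ (Fin n))}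
    {μ : Measure (EuclideanSpace ℝ (Fin n))} (h : IsProbOn K μ) (hK : IsCompact K)
    (m : EuclideanSpace ℝ (Fin n)) :
    (∫ x, ‖x - m‖ ^ 2 ∂μ) ^ 2 ≤ n * ∫ x, ∫ y, (inner ℝ (x - m) (y - m)) ^ 2 ∂μ ∂μ := by
  have := h.1
  set M : Fin n → Fin n → ℝ := fun i j => ∫ x, (x i - m i) * (x j - m j) ∂μ
  have hint : ∀ {g : EuclideanSpace ℝ (Fin n) → ℝ}, Continuous g → Integrable g μ :=
    fun hg => h.integrable hK hg
  have h1 : ∫ x, ‖x - m‖ ^ 2 ∂μ = ∑ i, M i i := by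
    rw [← integral_finsetSum _ (fun i _ => hint (by fun_prop))]
    congr 1; ext x
    rw [EuclideanSpace.real_norm_sq_eq]
    simp [sq]
  have h2 : ∫ x, ∫ y, (inner ℝ (x - m) (y - m)) ^ 2 ∂μ ∂μ = ∑ i, ∑ j, M i j ^ 2 := by
    have e : ∀ x : EuclideanSpace ℝ (Fin n), ∫ y, (inner ℝ (x - m) (y - m)) ^ 2 ∂μ
        = ∑ i, ∑ j, ((x i - m i) * (x j - m j)) * M i j := by
      intro x
      have e1 : ∀ y : EuclideanSpace ℝ (Fin n), (inner ℝ (x - m) (y - m)) ^ 2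
          = ∑ i, ∑ j, ((x i - m i) * (x j - m j)) * ((y i - m i) * (y j - m j)) := by
        intro y
        rw [PiLp.inner_apply, sq, Finset.sum_mul_sum]
        refine Finset.sum_congr rfl fun i _ => Finset.sum_congr rfl fun j _ => ?_
        simp
        ring
      simp_rw [e1]
      rw [integral_finsetSum _ (fun i _ => hint (by fun_prop))]
      refine Finset.sum_congr rfl fun i _ => ?_
      rw [integral_finsetSum _ (fun i _ => hint (by fun_prop))]
      refine Finset.sum_congr rfl fun j _ => ?_
      rw [integral_const_mul]
    simp_rw [e]
    rw [integral_finsetSum _ (fun i _ => hint (by fun_prop))]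
    refine Finset.sum_congr rfl fun i _ => ?_
    rw [integral_finsetSum _ (fun i _ => hint (by fun_prop))]
    refine Finset.sum_congr rfl fun j _ => ?_
    rw [integral_mul_const, sq]
  rw [h1, h2]
  -- Cauchy-Schwarz on the diagonal entries; the off-diagonal squares are then added for free.
  calc (∑ i, M i i) ^ 2 ≤ n * ∑ i, M i i ^ 2 := by
        simpa using sq_sum_le_card_mul_sum_sq (s := Finset.univ) (f := fun i => M i i)
    _ ≤ n * ∑ i, ∑ j, M i j ^ 2 := by
        gcongr with i
        exact Finset.single_le_sum (f := fun j => M i j ^ 2) (fun j _ => sq_nonneg _)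
          (Finset.mem_univ i)

lemma IsProbOn.integral_sub_mean {n : ℕ} {K : Set (EuclideanSpace ℝ (Fin n))}
    {μ : Measure (EuclideanSpace ℝ (Fin n))} (h : IsProbOn K μ) (hK : IsCompact K) :
    ∫ y, (y - ∫ x, x ∂μ) ∂μ = 0 := by
  have := h.1
  rw [integral_sub (h.integrable hK (by fun_prop)) (integrable_const _)]
  simp

lemma IsProbOn.integral_dist_sq {n : ℕ} {K : Set (EuclideanSpace ℝ (Fin n))}
    {μ : Measure (EuclideanSpace ℝ (Fin n))} (h : IsProbOn K μ) (hK : IsCompact K) :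
    ∫ x, ∫ y, dist x y ^ 2 ∂μ ∂μ = 2 * ∫ x, ‖x - ∫ z, z ∂μ‖ ^ 2 ∂μ := by
  have := h.1
  have h0 := h.integral_sub_mean hK
  set m := ∫ z, z ∂μ
  have hint : ∀ {g : EuclideanSpace ℝ (Fin n) → ℝ}, Continuous g → Integrable g μ :=
    fun hg => h.integrable hK hg
  have e : ∀ x : EuclideanSpace ℝ (Fin n), ∫ y, dist x y ^ 2 ∂μ
      = ‖x - m‖ ^ 2 + ∫ y, ‖y - m‖ ^ 2 ∂μ := by
    intro x
    have e1 : ∀ y, dist x y ^ 2 = (‖x - m‖ ^ 2 + ‖y - m‖ ^ 2) - 2 * inner ℝ (x - m) (y - m) := by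
      intro y
      rw [dist_eq_norm, ← sub_sub_sub_cancel_right x y m, norm_sub_sq_real]
      ring
    simp_rw [e1]
    rw [integral_sub (hint (by fun_prop)) (hint (by fun_prop)),
      integral_add (hint (by fun_prop)) (hint (by fun_prop)), integral_const_mul,
      integral_inner (h.integrable hK (by fun_prop)), h0]
    simp
  simp_rw [e]
  rw [integral_add (hint (by fun_prop)) (hint (by fun_prop))]
  simp
  ring

/-- Expand `dist x y ^ 4` in the vectors centred at the mean `m`: terms linear in `x - m` or `y - m`
integrate to zero, leaving `2B + 2s² + 4G`, where `G` is the double integral of the squared inner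
product. Then `B ≥ s²` and `n G ≥ s²` give the bound, as the second moment of the distance is `2s`.
-/
lemma IsProbOn.le_integral_dist_pow_four {n : ℕ} {K : Set (EuclideanSpace ℝ (Fin n))}
    {μ : Measure (EuclideanSpace ℝ (Fin n))} (h : IsProbOn K μ) (hK : IsCompact K) :
    (n + 1) * (∫ x, ∫ y, dist x y ^ 2 ∂μ ∂μ) ^ 2 ≤ n * ∫ x, ∫ y, dist x y ^ 4 ∂μ ∂μ := by
  have := h.1
  have h0 := h.integral_sub_mean hK
  rw [h.integral_dist_sq hK]
  set m := ∫ z, z ∂μ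
  have hint : ∀ {g : EuclideanSpace ℝ (Fin n) → ℝ}, Continuous g → Integrable g μ :=
    fun hg => h.integrable hK hg
  have hG := h.sq_moment_le hK m
  set s := ∫ x, ‖x - m‖ ^ 2 ∂μ
  set B := ∫ x, ‖x - m‖ ^ 4 ∂μ
  set v := ∫ y, ‖y - m‖ ^ 2 • (y - m) ∂μ
  -- The variance of `‖x - m‖ ^ 2` is nonnegative.
  have hB : s ^ 2 ≤ B := by
    have hnn : 0 ≤ ∫ x, (‖x - m‖ ^ 2 - s) ^ 2 ∂μ := integral_nonneg fun x => sq_nonneg _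
    have e1 : ∀ x, (‖x - m‖ ^ 2 - s) ^ 2 = ‖x - m‖ ^ 4 - (2 * s) * ‖x - m‖ ^ 2 + s ^ 2 := by
      intro x; ring
    simp_rw [e1] at hnn
    rw [integral_add (hint (by fun_prop)) (hint (by fun_prop)),
      integral_sub (hint (by fun_prop)) (hint (by fun_prop)), integral_const_mul] at hnn
    simp only [integral_const, probReal_univ, one_smul] at hnn
    change 0 ≤ B - 2 * s * s + s ^ 2 at hnn
    linarith
  have e : ∀ x : EuclideanSpace ℝ (Fin n), ∫ y, dist x y ^ 4 ∂μ
      = (‖x - m‖ ^ 4 + B + 2 * s * ‖x - m‖ ^ 2 - 4 * inner ℝ (x - m) v) +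
        4 * ∫ y, (inner ℝ (x - m) (y - m)) ^ 2 ∂μ := by
    intro x
    have e1 : ∀ y, dist x y ^ 4 = ‖x - m‖ ^ 4 + ‖y - m‖ ^ 4 + (2 * ‖x - m‖ ^ 2) * ‖y - m‖ ^ 2
        + 4 * (inner ℝ (x - m) (y - m)) ^ 2 - (4 * ‖x - m‖ ^ 2) * inner ℝ (x - m) (y - m)
        - 4 * inner ℝ (x - m) (‖y - m‖ ^ 2 • (y - m)) := by
      intro y
      rw [show dist x y ^ 4 = (dist x y ^ 2) ^ 2 by ring, dist_eq_norm,
        ← sub_sub_sub_cancel_right x y m, norm_sub_sq_real, inner_smul_right]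
      ring
    simp_rw [e1]
    rw [integral_sub (hint (by fun_prop)) (hint (by fun_prop)),
      integral_sub (hint (by fun_prop)) (hint (by fun_prop)),
      integral_add (hint (by fun_prop)) (hint (by fun_prop)),
      integral_add (hint (by fun_prop)) (hint (by fun_prop)),
      integral_add (hint (by fun_prop)) (hint (by fun_prop)),
      integral_const_mul, integral_const_mul, integral_const_mul, integral_const_mul,
      integral_inner (h.integrable hK (by fun_prop)),
      integral_inner (h.integrable hK (by fun_prop)), h0]
    simp only [integral_const, probReal_univ, one_smul, inner_zero_right]
    ring
  have hGc : Integrable (fun x => ∫ y, (inner ℝ (x - m) (y - m)) ^ 2 ∂μ) μ :=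
    (h.integrable_prod hK (g := fun z => (inner ℝ (z.1 - m) (z.2 - m)) ^ 2)
      (by fun_prop)).integral_prod_left
  simp_rw [e]
  rw [integral_add (hint (by fun_prop)) (hGc.const_mul 4),
    integral_sub (hint (by fun_prop)) (hint (by fun_prop)),
    integral_add (hint (by fun_prop)) (hint (by fun_prop)),
    integral_add (hint (by fun_prop)) (hint (by fun_prop)), integral_const_mul, integral_const_mul,
    integral_const_mul]
  have e3 : ∫ x, inner ℝ (x - m) v ∂μ = 0 := by
    simp_rw [real_inner_comm v]
    rw [integral_inner (h.integrable hK (by fun_prop)), h0, inner_zero_right]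
  rw [e3]
  simp only [integral_const, probReal_univ, one_smul]
  change _ ≤ (n : ℝ) * (B + B + 2 * s * s - 4 * 0 + 4 * _)
  have hnB : (n : ℝ) * s ^ 2 ≤ n * B := by gcongr
  nlinarith

/-! ### Diameter bound for the second moment and its equality case -/

lemma IsProbOn.integral_integral_mono {n : ℕ} {K : Set (EuclideanSpace ℝ (Fin n))}
    {μ : Measure (EuclideanSpace ℝ (Fin n))} (h : IsProbOn K μ) (hK : IsCompact K)
    {f g : EuclideanSpace ℝ (Fin n) → EuclideanSpace ℝ (Fin n) → ℝ}
    (hf : Continuous f.uncurry) (hg : Continuous g.uncurry)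
    (hfg : ∀ x ∈ K, ∀ y ∈ K, f x y ≤ g x y) :
    ∫ x, ∫ y, f x y ∂μ ∂μ ≤ ∫ x, ∫ y, g x y ∂μ ∂μ := by
  have := h.1
  refine integral_mono_ae (h.integrable_prod hK hf).integral_prod_left
    (h.integrable_prod hK hg).integral_prod_left ?_
  filter_upwards [h.ae_mem] with x hx
  refine integral_mono_ae (h.integrable hK (by fun_prop)) (h.integrable hK (by fun_prop)) ?_
  filter_upwards [h.ae_mem] with y hy using hfg x hx y hy

/-- The integrand vanishes almost everywhere for `μ.prod μ`. By continuity a nonzero value at a pair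
of support points would persist on a product of neighbourhoods, which has positive measure. -/
lemma IsProbOn.eq_zero_of_integral_eq_zero {n : ℕ} {K : Set (EuclideanSpace ℝ (Fin n))}
    {μ : Measure (EuclideanSpace ℝ (Fin n))} (h : IsProbOn K μ) (hK : IsCompact K)
    {f : EuclideanSpace ℝ (Fin n) → EuclideanSpace ℝ (Fin n) → ℝ}
    (hf : Continuous f.uncurry) (h0 : ∀ x ∈ K, ∀ y ∈ K, 0 ≤ f x y)
    (hint : ∫ x, ∫ y, f x y ∂μ ∂μ = 0) :
    ∀ x ∈ μ.support, ∀ y ∈ μ.support, f x y = 0 := by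
  have := h.1
  have hi := h.integrable_prod hK hf
  have h1 : ∫ z, f.uncurry z ∂(μ.prod μ) = 0 := by
    rw [integral_prod _ hi]; exact hint
  have hnn : 0 ≤ᵐ[μ.prod μ] f.uncurry := by
    filter_upwards [Measure.quasiMeasurePreserving_fst.ae h.ae_mem,
      Measure.quasiMeasurePreserving_snd.ae h.ae_mem] with z h1 h2 using h0 _ h1 _ h2
  rw [integral_eq_zero_iff_of_nonneg_ae hnn hi] at h1
  intro x hx y hy
  by_contra hne
  have hopen : IsOpen {z | f.uncurry z ≠ 0} := isOpen_ne_fun hf continuous_const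
  have hmem : (x, y) ∈ {z | f.uncurry z ≠ 0} := hne
  obtain ⟨U, V, hU, hV, hxU, hyV, hUV⟩ := isOpen_prod_iff.1 hopen x y hmem
  have hUpos := (Measure.mem_support_iff_forall x).1 hx U (hU.mem_nhds hxU)
  have hVpos := (Measure.mem_support_iff_forall y).1 hy V (hV.mem_nhds hyV)
  have : μ.prod μ (U ×ˢ V) = 0 := measure_mono_null hUV h1
  rw [Measure.prod_prod] at this
  exact (mul_ne_zero hUpos.ne' hVpos.ne') this

lemma continuous_uncurry_dist_pow {n : ℕ} (k : ℕ) : Continuous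
    (fun x y : EuclideanSpace ℝ (Fin n) => dist x y ^ k).uncurry := by
  simp only [Function.uncurry_def]; fun_prop

lemma continuous_uncurry_dist_rpow {n : ℕ} {p : ℝ} (hp : 0 ≤ p) : Continuous
    (fun x y : EuclideanSpace ℝ (Fin n) => dist x y ^ p).uncurry := by
  simp only [Function.uncurry_def]
  exact (continuous_fst.dist continuous_snd).rpow_const fun _ => Or.inr hp

lemma IsProbOn.integral_dist_pow_four_le {n : ℕ} {K : Set (EuclideanSpace ℝ (Fin n))}
    {μ : Measure (EuclideanSpace ℝ (Fin n))} (h : IsProbOn K μ) (hK : IsCompact K) :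
    ∫ x, ∫ y, dist x y ^ 4 ∂μ ∂μ ≤ Metric.diam K ^ 2 * ∫ x, ∫ y, dist x y ^ 2 ∂μ ∂μ := by
  simp_rw [← integral_const_mul]
  refine h.integral_integral_mono hK (continuous_uncurry_dist_pow 4)
    (continuous_const.mul (continuous_uncurry_dist_pow 2)) fun x hx y hy => ?_
  have := Metric.dist_le_diam_of_mem hK.isBounded hx hy
  rw [show dist x y ^ 4 = dist x y ^ 2 * dist x y ^ 2 by ring]
  gcongr

lemma IsProbOn.integral_dist_sq_le {n : ℕ} {K : Set (EuclideanSpace ℝ (Fin n))}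
    {μ : Measure (EuclideanSpace ℝ (Fin n))} (h : IsProbOn K μ) (hK : IsCompact K) :
    (n + 1) * ∫ x, ∫ y, dist x y ^ 2 ∂μ ∂μ ≤ n * Metric.diam K ^ 2 := by
  have h1 := h.le_integral_dist_pow_four hK
  have h2 := h.integral_dist_pow_four_le hK
  have h0 : 0 ≤ ∫ x, ∫ y, dist x y ^ 2 ∂μ ∂μ :=
    integral_nonneg fun x => integral_nonneg fun y => by positivity
  rcases h0.eq_or_lt with h0 | h0
  · rw [← h0, mul_zero]; positivity
  · refine le_of_mul_le_mul_right ?_ h0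
    have : (n : ℝ) * ∫ x, ∫ y, dist x y ^ 4 ∂μ ∂μ
        ≤ n * (Metric.diam K ^ 2 * ∫ x, ∫ y, dist x y ^ 2 ∂μ ∂μ) := by gcongr
    linarith

/-- In the case of equality in `IsProbOn.integral_dist_sq_le`, all positive distances in the support
are equal to the diameter. -/
lemma IsProbOn.dist_eq_diam_of_le {n : ℕ} (hn : n ≠ 0) {K : Set (EuclideanSpace ℝ (Fin n))}
    {μ : Measure (EuclideanSpace ℝ (Fin n))} (h : IsProbOn K μ) (hK : IsCompact K)
    (he : n * Metric.diam K ^ 2 ≤ (n + 1) * ∫ x, ∫ y, dist x y ^ 2 ∂μ ∂μ) :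
    ∀ x ∈ μ.support, ∀ y ∈ μ.support, x ≠ y → dist x y = Metric.diam K := by
  have := h.1
  have he' := le_antisymm he (h.integral_dist_sq_le hK)
  have h1 := h.le_integral_dist_pow_four hK
  have hnpos : (0 : ℝ) < n := by positivity
  -- Equality for `I₂` closes the chain `n D² I₂ = (n + 1) I₂² ≤ n I₄ ≤ n D² I₂`.
  have h2 : ∫ x, ∫ y, dist x y ^ 4 ∂μ ∂μ
      = Metric.diam K ^ 2 * ∫ x, ∫ y, dist x y ^ 2 ∂μ ∂μ := by
    refine le_antisymm (h.integral_dist_pow_four_le hK) (le_of_mul_le_mul_left ?_ hnpos)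
    calc (n : ℝ) * (Metric.diam K ^ 2 * ∫ x, ∫ y, dist x y ^ 2 ∂μ ∂μ)
        = (n * Metric.diam K ^ 2) * ∫ x, ∫ y, dist x y ^ 2 ∂μ ∂μ := by ring
      _ = (n + 1) * (∫ x, ∫ y, dist x y ^ 2 ∂μ ∂μ) ^ 2 := by rw [he']; ring
      _ ≤ _ := h1
  have hc4 := continuous_uncurry_dist_pow (n := n) 4
  have hc2 : Continuous (fun x y : EuclideanSpace ℝ (Fin n) =>
    Metric.diam K ^ 2 * dist x y ^ 2).uncurry := continuous_const.mul (continuous_uncurry_dist_pow 2)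
  have h3 : ∫ x, ∫ y, (Metric.diam K ^ 2 * dist x y ^ 2 - dist x y ^ 4) ∂μ ∂μ = 0 := by
    have e : ∀ x, ∫ y, (Metric.diam K ^ 2 * dist x y ^ 2 - dist x y ^ 4) ∂μ
        = ∫ y, Metric.diam K ^ 2 * dist x y ^ 2 ∂μ - ∫ y, dist x y ^ 4 ∂μ := fun x =>
      integral_sub (h.integrable hK (by fun_prop)) (h.integrable hK (by fun_prop))
    simp_rw [e]
    refine (integral_sub (h.integrable_prod hK hc2).integral_prod_left
      (h.integrable_prod hK hc4).integral_prod_left).trans ?_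
    simp only [Function.uncurry_apply_pair, integral_const_mul]
    rw [h2, sub_self]
  intro x hx y hy hxy
  have h4 := h.eq_zero_of_integral_eq_zero hK
    (f := fun x y => Metric.diam K ^ 2 * dist x y ^ 2 - dist x y ^ 4)
    (by simp only [Function.uncurry_def]; fun_prop) (fun x hx y hy => ?_) h3 x hx y hy
  · have hd := dist_pos.2 hxy
    have : dist x y ^ 2 * (Metric.diam K ^ 2 - dist x y ^ 2) = 0 := by
      linear_combination h4
    rcases mul_eq_zero.1 this with h5 | h5
    · exact absurd h5 (by positivity)
    · exact ((sq_eq_sq₀ Metric.diam_nonneg hd.le).1 (sub_eq_zero.1 h5)).symm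
  · have := Metric.dist_le_diam_of_mem hK.isBounded hx hy
    have : dist x y ^ 2 * dist x y ^ 2 ≤ Metric.diam K ^ 2 * dist x y ^ 2 := by gcongr
    change 0 ≤ Metric.diam K ^ 2 * dist x y ^ 2 - dist x y ^ 4
    linarith

/-! ### Energy bound for general exponent -/

/-- Reduces the kernel to the squared distance; `p ≥ 2` makes `d ^ (p - 2)` monotone in `d`. -/
lemma rpow_le_rpow_sub_two_mul_sq {d D p : ℝ} (hd : 0 ≤ d) (hdD : d ≤ D) (hp : 2 ≤ p) :
    d ^ p ≤ D ^ (p - 2) * d ^ 2 := by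
  rcases hd.eq_or_lt with rfl | hd
  · rw [Real.zero_rpow (by linarith)]; simp
  · rw [show p = (p - 2) + 2 by ring, Real.rpow_add hd, Real.rpow_two, add_sub_cancel_right]
    gcongr

lemma IsProbOn.measureEnergy_le_mul_integral_dist_sq {n : ℕ} {q : ℝ} (hq : q ≤ -2)
    {K : Set (EuclideanSpace ℝ (Fin n))}
    {μ : Measure (EuclideanSpace ℝ (Fin n))} (h : IsProbOn K μ) (hK : IsCompact K) :
    measureEnergy q μ ≤ Metric.diam K ^ (-q - 2) * ∫ x, ∫ y, dist x y ^ 2 ∂μ ∂μ := by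
  simp_rw [← integral_const_mul, measureEnergy]
  refine h.integral_integral_mono hK (continuous_uncurry_dist_rpow (by linarith))
    (continuous_const.mul (continuous_uncurry_dist_pow 2)) fun x hx y hy => ?_
  exact rpow_le_rpow_sub_two_mul_sq dist_nonneg (Metric.dist_le_diam_of_mem hK.isBounded hx hy)
    (by linarith)

lemma diam_pos {n : ℕ} {K : Set (EuclideanSpace ℝ (Fin n))} (hK : IsCompact K)
    (hK' : K.Nontrivial) : 0 < Metric.diam K := by
  obtain ⟨x, hx, y, hy, hxy⟩ := hK'
  exact (dist_pos.2 hxy).trans_le (Metric.dist_le_diam_of_mem hK.isBounded hx hy)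

lemma IsProbOn.measureEnergy_le {n : ℕ} {q : ℝ} (hq : q ≤ -2)
    {K : Set (EuclideanSpace ℝ (Fin n))} (hK' : K.Nontrivial)
    {μ : Measure (EuclideanSpace ℝ (Fin n))} (h : IsProbOn K μ) (hK : IsCompact K) :
    measureEnergy q μ ≤ Metric.diam K ^ (-q) * (n / (n + 1)) := by
  have hD := diam_pos hK hK'
  refine (h.measureEnergy_le_mul_integral_dist_sq hq hK).trans ?_
  rw [show Metric.diam K ^ (-q) = Metric.diam K ^ (-q - 2) * Metric.diam K ^ 2 by
    rw [← Real.rpow_two, ← Real.rpow_add hD]; ring_nf, mul_assoc]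
  gcongr
  rw [← mul_div_assoc, le_div_iff₀ (by positivity)]
  linarith [h.integral_dist_sq_le hK]

lemma IsProbOn.dist_eq_diam_of_energy {n : ℕ} (hn : n ≠ 0) {q : ℝ} (hq : q ≤ -2)
    {K : Set (EuclideanSpace ℝ (Fin n))} (hK' : K.Nontrivial)
    {μ : Measure (EuclideanSpace ℝ (Fin n))} (h : IsProbOn K μ) (hK : IsCompact K)
    (he : Metric.diam K ^ (-q) * (n / (n + 1)) ≤ measureEnergy q μ) :
    ∀ x ∈ μ.support, ∀ y ∈ μ.support, x ≠ y → dist x y = Metric.diam K := by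
  have hD := diam_pos hK hK'
  refine h.dist_eq_diam_of_le hn hK ?_
  have h1 := he.trans (h.measureEnergy_le_mul_integral_dist_sq hq hK)
  rw [show Metric.diam K ^ (-q) = Metric.diam K ^ (-q - 2) * Metric.diam K ^ 2 by
    rw [← Real.rpow_two, ← Real.rpow_add hD]; ring_nf, mul_assoc] at h1
  have h2 := le_of_mul_le_mul_left h1 (by positivity)
  rw [← mul_div_assoc, div_le_iff₀ (by positivity)] at h2
  linarith

/-! ### Measures on equidistant finite sets -/

/-- The energy of a measure on a finite set whose points have pairwise distance `D`. -/
lemma IsProbOn.measureEnergy_of_pairwise {n : ℕ} {q : ℝ} (hq : q ≤ -2)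
    {F : Finset (EuclideanSpace ℝ (Fin n))} {D : ℝ}
    (hF : ∀ x ∈ F, ∀ y ∈ F, x ≠ y → dist x y = D)
    {μ : Measure (EuclideanSpace ℝ (Fin n))} (h : IsProbOn (F : Set _) μ) :
    ∑ x ∈ F, μ.real {x} = 1 ∧
      measureEnergy q μ = D ^ (-q) * (1 - ∑ x ∈ F, μ.real {x} ^ 2) := by
  classical
  have := h.1
  have hi : ∀ g : EuclideanSpace ℝ (Fin n) → ℝ, ∫ x, g x ∂μ = ∑ x ∈ F, μ.real {x} * g x := by
    intro g
    conv_lhs => rw [← Measure.restrict_eq_self_of_ae_mem h.ae_mem]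
    rw [setIntegral_finset _ (IntegrableOn.finset)]
    rfl
  have h1 : ∑ x ∈ F, μ.real {x} = 1 := by
    have := hi (fun _ => 1)
    simpa using this.symm
  refine ⟨h1, ?_⟩
  -- The diagonal term drops out because `0 ^ (-q) = 0`, leaving the mass off `x`.
  have h2 : ∀ x ∈ F, ∑ y ∈ F, μ.real {y} * dist x y ^ (-q) = D ^ (-q) * (1 - μ.real {x}) := by
    intro x hx
    rw [← h1, ← Finset.sum_erase_add _ _ hx, ← Finset.sum_erase_add F (fun y => μ.real {y}) hx,
      add_sub_cancel_right, dist_self, Real.zero_rpow (by linarith), mul_zero, add_zero,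
      Finset.mul_sum]
    refine Finset.sum_congr rfl fun y hy => ?_
    rw [hF x hx y (Finset.mem_of_mem_erase hy) (Finset.ne_of_mem_erase hy).symm, mul_comm]
  rw [measureEnergy, hi]
  simp_rw [hi]
  rw [Finset.sum_congr rfl fun x hx => by rw [h2 x hx]]
  conv_rhs => rw [← h1, ← Finset.sum_sub_distrib, Finset.mul_sum]
  exact Finset.sum_congr rfl fun x hx => by ring

lemma isProbOn_uniformOn {n : ℕ} {F : Finset (EuclideanSpace ℝ (Fin n))} (hF : F.Nonempty) :
    IsProbOn (F : Set _) (uniformOn (F : Set (EuclideanSpace ℝ (Fin n)))) := by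
  refine ⟨isProbabilityMeasure_uniformOn F.finite_toSet hF, ?_⟩
  rw [uniformOn_eq_zero_iff F.finite_toSet]
  simp

lemma uniformOn_real_singleton {n : ℕ} {F : Finset (EuclideanSpace ℝ (Fin n))}
    {x : EuclideanSpace ℝ (Fin n)} (hx : x ∈ F) :
    (uniformOn (F : Set (EuclideanSpace ℝ (Fin n)))).real {x} = (F.card : ℝ)⁻¹ := by
  classical
  have := uniformOn_apply_finset (s := F) (t := {x})
  rw [Finset.coe_singleton] at this
  rw [measureReal_def, this, Finset.inter_singleton_of_mem hx]
  simp

lemma measureEnergy_uniformOn {n : ℕ} {q : ℝ} (hq : q ≤ -2)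
    {F : Finset (EuclideanSpace ℝ (Fin n))} (hne : F.Nonempty) {D : ℝ}
    (hF : ∀ x ∈ F, ∀ y ∈ F, x ≠ y → dist x y = D) :
    measureEnergy q (uniformOn (F : Set (EuclideanSpace ℝ (Fin n)))) =
      D ^ (-q) * (1 - (F.card : ℝ)⁻¹) := by
  rw [((isProbOn_uniformOn hne).measureEnergy_of_pairwise hq hF).2,
    Finset.sum_congr rfl fun x hx => by rw [uniformOn_real_singleton hx]]
  have : (F.card : ℝ) ≠ 0 := by simpa using hne.ne_empty
  simp
  left
  field_simp

lemma eq_uniformOn {n : ℕ} {F : Finset (EuclideanSpace ℝ (Fin n))} (hne : F.Nonempty)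
    {μ : Measure (EuclideanSpace ℝ (Fin n))} (h : IsProbOn (F : Set _) μ)
    (hw : ∀ x ∈ F, μ.real {x} = (F.card : ℝ)⁻¹) :
    μ = uniformOn (F : Set (EuclideanSpace ℝ (Fin n))) := by
  classical
  have h' := isProbOn_uniformOn hne
  have := h.1
  have := h'.1
  have key : ∀ ν : Measure (EuclideanSpace ℝ (Fin n)), IsProbOn (F : Set _) ν → ∀ s,
      MeasurableSet s → ν s = ∑ x ∈ F with x ∈ s, ν {x} := by
    intro ν hν s hs
    rw [sum_measure_singleton]
    refine measure_congr ?_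
    filter_upwards [hν.ae_mem] with x hx
    simp only [Finset.coe_filter, eq_iff_iff]
    exact ⟨fun hs => ⟨hx, hs⟩, fun hs => hs.2⟩
  ext s hs
  rw [key _ h s hs, key _ h' s hs]
  refine Finset.sum_congr rfl fun x hx => ?_
  have hx := (Finset.mem_filter.1 hx).1
  rw [← ENNReal.toReal_eq_toReal_iff' (measure_ne_top _ _) (measure_ne_top _ _)]
  exact (hw x hx).trans (uniformOn_real_singleton hx).symm

lemma diam_of_pairwise {n : ℕ} {T : Set (EuclideanSpace ℝ (Fin n))} {D : ℝ} (hD : 0 ≤ D)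
    (hT : ∀ x ∈ T, ∀ y ∈ T, x ≠ y → dist x y = D) (hT' : T.Nontrivial) :
    Metric.diam T = D := by
  have hle : ∀ x ∈ T, ∀ y ∈ T, dist x y ≤ D := by
    intro x hx y hy
    rcases eq_or_ne x y with rfl | hxy
    · simpa using hD
    · exact (hT x hx y hy hxy).le
  refine le_antisymm (Metric.diam_le_of_forall_dist_le hD hle) ?_
  obtain ⟨x, hx, y, hy, hxy⟩ := hT'
  rw [← hT x hx y hy hxy]
  exact Metric.dist_le_diam_of_mem (Metric.isBounded_iff.2 ⟨D, fun x hx y hy => hle x hx y hy⟩) hx hy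

/-- For `N` such points the uniform measure has energy `D² (1 - 1/N)` at `q = -2`, and the general
bound `D² n / (n + 1)` forces `N ≤ n + 1`. -/
lemma card_le_of_pairwise {n : ℕ}
    {F : Finset (EuclideanSpace ℝ (Fin n))} {D : ℝ} (hD : 0 < D)
    (hF : ∀ x ∈ F, ∀ y ∈ F, x ≠ y → dist x y = D) : F.card ≤ n + 1 := by
  rcases F.eq_empty_or_nonempty with rfl | hne
  · simp
  rcases (F : Set (EuclideanSpace ℝ (Fin n))).subsingleton_or_nontrivial with hs | hs
  · have : F.card ≤ 1 := Finset.card_le_one.2 fun a ha b hb => hs ha hb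
    omega
  have h1 := (isProbOn_uniformOn hne).measureEnergy_le (le_refl (-2)) hs F.finite_toSet.isCompact
  rw [measureEnergy_uniformOn le_rfl hne hF, diam_of_pairwise hD.le hF hs] at h1
  have h2 := le_of_mul_le_mul_left h1 (by positivity)
  have hc : (0 : ℝ) < F.card := by exact_mod_cast hne.card_pos
  rw [le_div_iff₀ (by positivity)] at h2
  have h3 : (F.card : ℝ)⁻¹ * F.card = 1 := inv_mul_cancel₀ hc.ne'
  have h4 : (F.card : ℝ) ≤ n + 1 := by
    have : (1 : ℝ) ≤ (F.card : ℝ)⁻¹ * (n + 1) := by linarith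
    calc (F.card : ℝ) = F.card * 1 := by ring
      _ ≤ F.card * ((F.card : ℝ)⁻¹ * (n + 1)) := by gcongr
      _ = n + 1 := by rw [← mul_assoc, mul_comm (F.card : ℝ), h3, one_mul]
  exact_mod_cast h4

/-- Expanding, `∑ (w - 1/N)² ≤ 1/N - 2/N + 1/N = 0`, so every weight is `1/N`; total mass one then
fixes the number of points. -/
lemma card_eq_and_uniform {ι : Type*} {F : Finset ι} {w : ι → ℝ} {N : ℕ} (hN : N ≠ 0)
    (hcard : F.card ≤ N) (h1 : ∑ x ∈ F, w x = 1) (h2 : ∑ x ∈ F, w x ^ 2 ≤ (N : ℝ)⁻¹) :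
    F.card = N ∧ ∀ x ∈ F, w x = (N : ℝ)⁻¹ := by
  have hN' : (0 : ℝ) < N := by positivity
  have h3 : ∑ x ∈ F, (w x - (N : ℝ)⁻¹) ^ 2 ≤ 0 := by
    have e : ∑ x ∈ F, (w x - (N : ℝ)⁻¹) ^ 2
        = ∑ x ∈ F, w x ^ 2 - 2 * (N : ℝ)⁻¹ * ∑ x ∈ F, w x + F.card * ((N : ℝ)⁻¹) ^ 2 := by
      rw [Finset.mul_sum, ← Finset.sum_sub_distrib, ← nsmul_eq_mul, ← Finset.sum_const,
        ← Finset.sum_add_distrib]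
      exact Finset.sum_congr rfl fun x _ => by ring
    have h4 : (F.card : ℝ) * ((N : ℝ)⁻¹) ^ 2 ≤ N * ((N : ℝ)⁻¹) ^ 2 := by gcongr
    have h5 : (N : ℝ) * ((N : ℝ)⁻¹) ^ 2 = (N : ℝ)⁻¹ := by field_simp
    rw [e, h1]; linarith
  have h4 := (Finset.sum_eq_zero_iff_of_nonneg fun x _ => sq_nonneg _).1
    (le_antisymm h3 (Finset.sum_nonneg fun x _ => sq_nonneg _))
  have h5 : ∀ x ∈ F, w x = (N : ℝ)⁻¹ := fun x hx =>
    sub_eq_zero.1 (pow_eq_zero_iff two_ne_zero |>.1 (h4 x hx))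
  refine ⟨?_, h5⟩
  rw [Finset.sum_congr rfl h5, Finset.sum_const, nsmul_eq_mul] at h1
  have : (F.card : ℝ) = N := by field_simp at h1; exact h1
  exact_mod_cast this

/-! ### Regular simplices -/

/-- For weights of sum zero, `‖∑ w p‖² = -½ ∑ w w d² = ½ D² ∑ w²`, so an affine relation has only
zero weights. -/
lemma affineIndependent_of_dist_eq {ι V : Type*} [NormedAddCommGroup V] [InnerProductSpace ℝ V]
    {p : ι → V} {D : ℝ} (hD : 0 < D) (hp : ∀ i j, i ≠ j → dist (p i) (p j) = D) :
    AffineIndependent ℝ p := by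
  classical
  intro s w hw h0 i hi
  have h1 := EuclideanGeometry.inner_weightedVSub (s₁ := s) (w₁ := w) p hw p hw
  rw [h0, inner_zero_left] at h1
  have h2 : ∀ a ∈ s, ∑ b ∈ s, w a * w b * (dist (p a) (p b) * dist (p a) (p b))
      = -(D ^ 2 * w a ^ 2) := by
    intro a ha
    have e : ∑ b ∈ s.erase a, w b = -w a := by
      rw [← Finset.sum_erase_add _ _ ha] at hw; linarith
    rw [← Finset.sum_erase_add _ _ ha, dist_self, mul_zero, mul_zero, add_zero,
      Finset.sum_congr rfl fun b hb => by rw [hp a b (Finset.ne_of_mem_erase hb).symm],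
      ← Finset.sum_mul, ← Finset.mul_sum, e]
    ring
  rw [Finset.sum_congr rfl h2, Finset.sum_neg_distrib, neg_neg, ← Finset.mul_sum] at h1
  have h3 : ∑ a ∈ s, w a ^ 2 = 0 := by
    have : D ^ 2 * ∑ a ∈ s, w a ^ 2 = 0 := by linarith
    exact (mul_eq_zero.1 this).resolve_left (by positivity)
  have := (Finset.sum_eq_zero_iff_of_nonneg fun x _ => sq_nonneg _).1 h3 i hi
  exact pow_eq_zero_iff two_ne_zero |>.1 this

lemma isRegularPointSet_of_dist_eq {n m : ℕ} {D : ℝ} (hD : 0 < D)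
    {p : Fin (m + 1) → EuclideanSpace ℝ (Fin n)} (hp : ∀ i j, i ≠ j → dist (p i) (p j) = D) :
    IsRegularPointSet m (Set.range p) :=
  ⟨⟨p, affineIndependent_of_dist_eq hD hp⟩, ⟨D, hp⟩, rfl⟩

lemma isRegularPointSet_coe {n m : ℕ} {D : ℝ} (hD : 0 < D)
    {F : Finset (EuclideanSpace ℝ (Fin n))} (hcard : F.card = m + 1)
    (hF : ∀ x ∈ F, ∀ y ∈ F, x ≠ y → dist x y = D) :
    IsRegularPointSet m (F : Set (EuclideanSpace ℝ (Fin n))) := by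
  let e := (F.equivFinOfCardEq hcard).symm
  have h := isRegularPointSet_of_dist_eq (m := m) (p := fun i => (e i : EuclideanSpace ℝ (Fin n))) hD
    fun i j hij => hF _ (e i).2 _ (e j).2
      (fun h => hij (e.injective (Subtype.ext h)))
  convert h using 1
  ext x
  constructor
  · intro hx
    exact ⟨e.symm ⟨x, hx⟩, by simp⟩
  · rintro ⟨i, rfl⟩
    exact (e i).2

lemma IsRegularPointSet.exists_finset {n m : ℕ} (hm : m ≠ 0)
    {T : Set (EuclideanSpace ℝ (Fin n))} (hT : IsRegularPointSet m T) :
    ∃ (F : Finset (EuclideanSpace ℝ (Fin n))) (D : ℝ), 0 < D ∧ (F : Set _) = T ∧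
      F.card = m + 1 ∧ ∀ x ∈ F, ∀ y ∈ F, x ≠ y → dist x y = D := by
  classical
  obtain ⟨s, ⟨D, hD⟩, rfl⟩ := hT
  have hinj := s.independent.injective
  refine ⟨Finset.univ.image s.points, D, ?_, by simp, ?_, ?_⟩
  · have h : (0 : Fin (m + 1)) ≠ Fin.last m := by
      rw [Ne, Fin.ext_iff]; simpa using hm.symm
    rw [← hD _ _ h]
    exact dist_pos.2 (hinj.ne h)
  · rw [Finset.card_image_of_injective _ hinj]; simp
  · simp only [Finset.mem_image, Finset.mem_univ, true_and]
    rintro _ ⟨i, rfl⟩ _ ⟨j, rfl⟩ hij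
    exact hD i j fun h => hij (by rw [h])

lemma exists_isRegularPointSet {n : ℕ} (hn : n ≠ 0) :
    ∃ T : Set (EuclideanSpace ℝ (Fin n)), IsRegularPointSet n T := by
  -- The vertices are the standard basis and `(t, …, t)`. The squared distance from a basis vector
  -- to the latter is `1 - 2t + n t²`, so `t` is chosen as a root of `n t² - 2t = 1`, giving `2`.
  set t : ℝ := (1 + √(n + 1)) / n with ht
  have hn' : (n : ℝ) ≠ 0 := by exact_mod_cast hn
  have hq : n * t ^ 2 - 2 * t = 1 := by
    have := Real.sq_sqrt (show (0 : ℝ) ≤ n + 1 by positivity)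
    have h2 : n * t = 1 + √(n + 1) := by rw [ht]; field_simp
    have : (n : ℝ) * (n * t ^ 2 - 2 * t) = n * 1 := by
      calc (n : ℝ) * (n * t ^ 2 - 2 * t) = (n * t) ^ 2 - 2 * (n * t) := by ring
        _ = (n : ℝ) * 1 := by rw [h2]; linarith
    exact mul_left_cancel₀ hn' this
  have ha : ∀ i : Fin n, dist (EuclideanSpace.single i (1 : ℝ)) (WithLp.toLp 2 fun _ : Fin n => t)
      = √2 := by
    intro i
    rw [EuclideanSpace.dist_eq]
    congr 1
    simp only [Real.dist_eq, sq_abs, PiLp.single_apply]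
    have : ∀ j, ((if j = i then (1 : ℝ) else 0) - t) ^ 2
        = (if j = i then 1 - 2 * t else 0) + t ^ 2 := by
      intro j; split_ifs <;> ring
    simp_rw [this]
    rw [Finset.sum_add_distrib]
    simp
    linarith
  have hb : ∀ i j : Fin n, i ≠ j →
      dist (EuclideanSpace.single i (1 : ℝ)) (EuclideanSpace.single j (1 : ℝ)) = √2 := by
    intro i j hij
    rw [EuclideanSpace.dist_eq]
    congr 1
    simp only [Real.dist_eq, sq_abs, PiLp.single_apply]
    have : ∀ k, ((if k = i then (1 : ℝ) else 0) - (if k = j then (1 : ℝ) else 0)) ^ 2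
        = (if k = i then 1 else 0) + (if k = j then 1 else 0) := by
      intro k
      split_ifs with h1 h2
      · exact absurd (h1.symm.trans h2) hij
      all_goals norm_num
    simp_rw [this]
    rw [Finset.sum_add_distrib]
    simp
    norm_num
  refine ⟨_, isRegularPointSet_of_dist_eq (D := √2) (by positivity)
    (p := Fin.cons (WithLp.toLp 2 fun _ : Fin n => t) fun i => EuclideanSpace.single i 1) ?_⟩
  intro i j
  refine Fin.cases ?_ (fun i => ?_) i <;> refine Fin.cases ?_ (fun j => ?_) j
  · simp
  · intro _; simpa [dist_comm] using ha j
  · intro _; simpa using ha i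
  · intro hij
    simpa using hb i j fun h => hij (by rw [h])

/-! ### Existence of equilibrium measures -/

/-- Probability measures on the compact space `K` form a weakly compact space, and the energy is
weakly continuous: `ν ↦ ν.prod ν` is continuous and the kernel is bounded and continuous. Measures
on `K` and on the ambient space correspond through the inclusion. -/
lemma exists_isEquilibrium {n : ℕ} {q : ℝ} (hq : q ≤ 0) {K : Set (EuclideanSpace ℝ (Fin n))}
    (hK : IsCompact K) (hne : K.Nonempty) : ∃ μ, IsEquilibrium q K μ := by
  have : CompactSpace K := isCompact_iff_compactSpace.1 hK
  have : Nonempty K := hne.to_subtype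
  have hemb : MeasurableEmbedding ((↑) : K → EuclideanSpace ℝ (Fin n)) :=
    MeasurableEmbedding.subtype_coe hK.measurableSet
  let f : BoundedContinuousFunction (K × K) ℝ := BoundedContinuousFunction.mkOfCompact
    ⟨fun z => dist z.1 z.2 ^ (-q), (continuous_fst.dist continuous_snd).rpow_const
      fun _ => Or.inr (by linarith)⟩
  have hcont : Continuous fun ν : ProbabilityMeasure K => ∫ z, f z ∂((ν.prod ν : ProbabilityMeasure
      (K × K)) : Measure (K × K)) :=
    (ProbabilityMeasure.continuous_integral_boundedContinuousFunction f).comp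
      (ProbabilityMeasure.continuous_prod.comp (continuous_id.prodMk continuous_id))
  have hmap : ∀ ν : ProbabilityMeasure K, measureEnergy q ((ν : Measure K).map Subtype.val) =
      ∫ z, f z ∂((ν.prod ν : ProbabilityMeasure (K × K)) : Measure (K × K)) := by
    intro ν
    rw [ProbabilityMeasure.toMeasure_prod, integral_prod _ (f.integrable _), measureEnergy,
      hemb.integral_map]
    simp_rw [hemb.integral_map]
    rfl
  have hprob : ∀ ν : ProbabilityMeasure K, IsProbOn K ((ν : Measure K).map Subtype.val) := by
    intro ν
    refine ⟨Measure.isProbabilityMeasure_map hemb.measurable.aemeasurable, ?_⟩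
    rw [hemb.map_apply]
    simp
  have : Nonempty (ProbabilityMeasure K) :=
    ⟨⟨Measure.dirac (Classical.arbitrary K), Measure.dirac.isProbabilityMeasure⟩⟩
  obtain ⟨ν, -, hν⟩ := isCompact_univ.exists_isMaxOn Set.univ_nonempty hcont.continuousOn
  refine ⟨(ν : Measure K).map Subtype.val, hprob ν, fun μ hμ => ?_⟩
  have := hμ.1
  have hc : (μ.comap ((↑) : K → EuclideanSpace ℝ (Fin n))).map (↑) = μ := by
    rw [hemb.map_comap, Subtype.range_coe, Measure.restrict_eq_self_of_ae_mem hμ.ae_mem]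
  have hcp : IsProbabilityMeasure (μ.comap ((↑) : K → EuclideanSpace ℝ (Fin n))) := by
    refine ⟨?_⟩
    rw [← Set.preimage_univ (f := ((↑) : K → EuclideanSpace ℝ (Fin n))), ← hemb.map_apply, hc,
      measure_univ]
  have h1 := hν (Set.mem_univ (⟨_, hcp⟩ : ProbabilityMeasure K))
  simp only [← hmap] at h1
  change measureEnergy q ((μ.comap ((↑) : K → EuclideanSpace ℝ (Fin n))).map Subtype.val) ≤ _ at h1
  rwa [hc] at h1

/-! ### Capacity and maximizing sets -/

lemma IsEquilibrium.rieszEnergy_eq {n : ℕ} {q : ℝ} {K : Set (EuclideanSpace ℝ (Fin n))}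
    {μ : Measure (EuclideanSpace ℝ (Fin n))} (h : IsEquilibrium q K μ) :
    rieszEnergy q K = measureEnergy q μ :=
  IsGreatest.csSup_eq ⟨⟨μ, h.1, rfl⟩, by rintro _ ⟨ν, hν, rfl⟩; exact h.2 ν hν⟩

lemma measureEnergy_nonneg {n : ℕ} {q : ℝ} (μ : Measure (EuclideanSpace ℝ (Fin n))) :
    0 ≤ measureEnergy q μ :=
  integral_nonneg fun _ => integral_nonneg fun _ => Real.rpow_nonneg dist_nonneg _

lemma rpow_mul_rpow_neg_one_div {q D c : ℝ} (hq : q ≤ -2) (hD : 0 ≤ D) (hc : 0 ≤ c) :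
    (D ^ (-q) * c) ^ (-1 / q) = D * c ^ (-1 / q) := by
  rw [Real.mul_rpow (Real.rpow_nonneg hD _) hc, ← Real.rpow_mul hD]
  have : -q * (-1 / q) = 1 := by have : q ≠ 0 := by linarith
                                 field_simp
  rw [this, Real.rpow_one]

lemma rieszEnergy_nonneg_le {n : ℕ} {q : ℝ} (hq : q ≤ -2) {K : Set (EuclideanSpace ℝ (Fin n))}
    (hK : IsCompact K) (hK' : K.Nontrivial) :
    0 ≤ rieszEnergy q K ∧ rieszEnergy q K ≤ Metric.diam K ^ (-q) * (n / (n + 1)) := by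
  obtain ⟨μ, hμ⟩ := exists_isEquilibrium (q := q) (by linarith) hK hK'.nonempty
  rw [hμ.rieszEnergy_eq]
  exact ⟨measureEnergy_nonneg μ, hμ.1.measureEnergy_le hq hK' hK⟩

lemma rieszCapacity_div_diam_le {n : ℕ} {q : ℝ} (hq : q ≤ -2) {K : Set (EuclideanSpace ℝ (Fin n))}
    (hK : IsCompact K) (hK' : K.Nontrivial) :
    rieszCapacity q K / Metric.diam K ≤ (n / (n + 1) : ℝ) ^ (-1 / q) := by
  have h := rieszEnergy_nonneg_le hq hK hK'
  rw [div_le_iff₀ (diam_pos hK hK'), mul_comm,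
    ← rpow_mul_rpow_neg_one_div hq Metric.diam_nonneg (by positivity)]
  exact Real.rpow_le_rpow h.1 h.2 (div_nonneg_of_nonpos (by norm_num) (by linarith))

lemma IsRegularPointSet.isCompact_nontrivial_rieszEnergy {n : ℕ} (hn : n ≠ 0) {q : ℝ} (hq : q ≤ -2)
    {T : Set (EuclideanSpace ℝ (Fin n))} (hT : IsRegularPointSet n T) :
    IsCompact T ∧ T.Nontrivial ∧ rieszEnergy q T = Metric.diam T ^ (-q) * (n / (n + 1)) := by
  obtain ⟨F, D, hD, rfl, hcard, hF⟩ := hT.exists_finset hn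
  have hK : IsCompact (F : Set (EuclideanSpace ℝ (Fin n))) := F.finite_toSet.isCompact
  have hK' : (F : Set (EuclideanSpace ℝ (Fin n))).Nontrivial :=
    Finset.one_lt_card_iff_nontrivial.1 (by omega)
  refine ⟨hK, hK', le_antisymm (rieszEnergy_nonneg_le hq hK hK').2 ?_⟩
  have hne : F.Nonempty := Finset.card_pos.1 (by omega)
  obtain ⟨μ, hμ⟩ := exists_isEquilibrium (q := q) (by linarith) hK hne
  have h := hμ.2 _ (isProbOn_uniformOn hne)
  rw [hμ.rieszEnergy_eq, diam_of_pairwise hD.le hF hK']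
  refine le_trans (le_of_eq ?_) h
  rw [measureEnergy_uniformOn hq hne hF, hcard]
  congr 1
  push_cast
  field_simp
  ring

lemma IsRegularPointSet.rieszCapacity_eq {n : ℕ} (hn : n ≠ 0) {q : ℝ} (hq : q ≤ -2)
    {T : Set (EuclideanSpace ℝ (Fin n))} (hT : IsRegularPointSet n T) :
    rieszCapacity q T = Metric.diam T * (n / (n + 1) : ℝ) ^ (-1 / q) := by
  rw [rieszCapacity, (hT.isCompact_nontrivial_rieszEnergy hn hq).2.2,
    rpow_mul_rpow_neg_one_div hq Metric.diam_nonneg (by positivity)]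

lemma IsRegularPointSet.isMaximizer {n : ℕ} (hn : n ≠ 0) {q : ℝ} (hq : q ≤ -2)
    {T : Set (EuclideanSpace ℝ (Fin n))} (hT : IsRegularPointSet n T) : IsMaximizer q T := by
  obtain ⟨hK, hK', -⟩ := hT.isCompact_nontrivial_rieszEnergy hn hq
  refine ⟨hK, hK', fun L hL hL' => (rieszCapacity_div_diam_le hq hL hL').trans_eq ?_⟩
  rw [hT.rieszCapacity_eq hn hq, mul_div_cancel_left₀ _ (diam_pos hK hK').ne']

/-- Comparison with one regular `(n+1)`-point set shows that the ratio reaches the upper bound; as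
`-1 / q > 0`, the power can be undone to recover the energy. -/
lemma IsMaximizer.rieszEnergy_eq {n : ℕ} (hn : n ≠ 0) {q : ℝ} (hq : q ≤ -2)
    {K : Set (EuclideanSpace ℝ (Fin n))} (h : IsMaximizer q K) :
    rieszEnergy q K = Metric.diam K ^ (-q) * (n / (n + 1)) := by
  obtain ⟨hK, hK', hmax⟩ := h
  have hV := rieszEnergy_nonneg_le hq hK hK'
  obtain ⟨T, hT⟩ := exists_isRegularPointSet hn
  obtain ⟨hTc, hTn, -⟩ := hT.isCompact_nontrivial_rieszEnergy hn hq
  have h1 := hmax T hTc hTn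
  rw [hT.rieszCapacity_eq hn hq, mul_div_cancel_left₀ _ (diam_pos hTc hTn).ne',
    le_div_iff₀ (diam_pos hK hK'), mul_comm,
    ← rpow_mul_rpow_neg_one_div hq Metric.diam_nonneg (by positivity)] at h1
  refine le_antisymm hV.2 ?_
  exact (Real.rpow_le_rpow_iff (mul_nonneg (Real.rpow_nonneg Metric.diam_nonneg _) (by positivity))
    hV.1 (div_pos_of_neg_of_neg (by norm_num) (by linarith))).1 h1

lemma IsProbOn.support_subset {n : ℕ} {K : Set (EuclideanSpace ℝ (Fin n))}
    {μ : Measure (EuclideanSpace ℝ (Fin n))} (h : IsProbOn K μ) (hK : IsClosed K) :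
    μ.support ⊆ K := by
  intro x hx
  by_contra hxK
  exact ((Measure.mem_support_iff_forall x).1 hx _ (hK.isOpen_compl.mem_nhds hxK)).ne' h.2

/-- An extremal equilibrium measure is uniform on a regular `(n+1)`-point set. -/
lemma IsProbOn.exists_eq_uniformOn {n : ℕ} (hn : n ≠ 0) {q : ℝ} (hq : q ≤ -2)
    {K : Set (EuclideanSpace ℝ (Fin n))} (hK : IsCompact K) (hK' : K.Nontrivial)
    {μ : Measure (EuclideanSpace ℝ (Fin n))} (h : IsProbOn K μ)
    (he : Metric.diam K ^ (-q) * (n / (n + 1)) ≤ measureEnergy q μ) :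
    ∃ T : Set (EuclideanSpace ℝ (Fin n)), T ⊆ K ∧ IsRegularPointSet n T ∧ μ = uniformOn T ∧
      Metric.diam T = Metric.diam K := by
  have hD := diam_pos hK hK'
  have := h.1
  have hd := h.dist_eq_diam_of_energy hn hq hK' hK he
  have hfin : μ.support.Finite := by
    -- An infinite support would contain `n + 2` equidistant points.
    by_contra hinf
    obtain ⟨G, hG, hcard⟩ := Set.Infinite.exists_subset_card_eq hinf (n + 2)
    have := card_le_of_pairwise hD fun x hx y hy => hd x (hG hx) y (hG hy)
    omega
  obtain ⟨F, hF⟩ := hfin.exists_finset_coe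
  rw [← hF] at hd
  have hμF : IsProbOn (F : Set (EuclideanSpace ℝ (Fin n))) μ :=
    ⟨h.1, by rw [hF]; exact Measure.support_mem_ae⟩
  obtain ⟨h1, h2⟩ := hμF.measureEnergy_of_pairwise hq hd
  rw [h2] at he
  have h3 := le_of_mul_le_mul_left he (by positivity)
  -- Extremality reads `n / (n + 1) ≤ 1 - ∑ w²`.
  have h4 : ∑ x ∈ F, μ.real {x} ^ 2 ≤ (((n + 1 : ℕ) : ℝ))⁻¹ := by
    have : (n : ℝ) / (n + 1) = 1 - (((n + 1 : ℕ) : ℝ))⁻¹ := by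
      push_cast; field_simp; ring
    linarith
  obtain ⟨hcard, hw⟩ := card_eq_and_uniform n.succ_ne_zero (card_le_of_pairwise hD hd) h1 h4
  have hne : F.Nonempty := Finset.card_pos.1 (by omega)
  refine ⟨F, hF ▸ h.support_subset hK.isClosed, isRegularPointSet_coe hD hcard hd,
    eq_uniformOn hne hμF fun x hx => by rw [hw x hx, hcard], diam_of_pairwise hD.le hd ?_⟩
  exact Finset.one_lt_card_iff_nontrivial.1 (by omega)

end RieszCap

theorem mainTheorem6 (n : ℕ) (hn : 2 ≤ n) (q : ℝ) (hq : q ≤ -2) :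
    (∃ T : Set (EuclideanSpace ℝ (Fin n)), RieszCap.IsRegularPointSet n T) ∧
    (∀ T : Set (EuclideanSpace ℝ (Fin n)),
      RieszCap.IsRegularPointSet n T → RieszCap.IsMaximizer q T) ∧
    (∀ K : Set (EuclideanSpace ℝ (Fin n)), RieszCap.IsMaximizer q K →
      (∃ μ : Measure (EuclideanSpace ℝ (Fin n)), RieszCap.IsEquilibrium q K μ) ∧
      ∀ μ : Measure (EuclideanSpace ℝ (Fin n)), RieszCap.IsEquilibrium q K μ →
        ∃ T : Set (EuclideanSpace ℝ (Fin n)), T ⊆ K ∧ RieszCap.IsRegularPointSet n T ∧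
          μ = uniformOn T ∧
          RieszCap.rieszCapacity q T = RieszCap.rieszCapacity q K ∧
          Metric.diam T = Metric.diam K) := by
  have hn0 : n ≠ 0 := by omega
  refine ⟨RieszCap.exists_isRegularPointSet hn0, fun T hT => hT.isMaximizer hn0 hq,
    fun K hK => ⟨RieszCap.exists_isEquilibrium (by linarith) hK.1 hK.2.1.nonempty, ?_⟩⟩
  intro μ hμ
  have he := hK.rieszEnergy_eq hn0 hq
  obtain ⟨T, hTK, hT, hμT, hdiam⟩ := hμ.1.exists_eq_uniformOn hn0 hq hK.1 hK.2.1
    (he.symm.le.trans_eq hμ.rieszEnergy_eq)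
  refine ⟨T, hTK, hT, hμT, ?_, hdiam⟩
  rw [RieszCap.rieszCapacity, RieszCap.rieszCapacity, he,
    (hT.isCompact_nontrivial_rieszEnergy hn0 hq).2.2, hdiam]
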